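/- **Setting.** Consider an $M/M/c/S$ queue with $c\ge 1$ servers of rate $\mu>0$, capacity $S$, states $s\in\{0,\dots,S\}$, service rates $\mu(s)=\min(s,c)\mu$, $\mu_{\max}=\mu(S)$, and job classes $i=1,\dots,m$ with immediate rewards $0\le R^{(i)}\le R_{\max}$ and nondecreasing holding cost functions $C^{(i)}:[0,\infty)\to[0,\infty)$ with $C^{(i)}(0)=0$. Admitting a class-$i$ job in state $s<S$ has expected reward $r^{(i)}(s)=R^{(i)}-\mathbb E[C^{(i)}(W(s))]$ (assumed finite), where $W(s)=0$ if $s<c$ and $W(s)$ is Erlang with shape $s-c+1$ and rate $c\mu$ if $s\ge c$. The confidence set $\mathcal C$ consists of the CTMDPs with state-dependent arrival rates $\lambda^{(i)}(s)=\Lambda p^{(i)}(s)$, where $\Lambda\in[\hat\Lambda-\varepsilon_\Lambda,\hat\Lambda+\varepsilon_\Lambda]\cap[\Lambda_{\min},\Lambda_{\max}]$, $\Lambda_{\min}>0$, and, for every $s$, $p(s)$ lies in the set $CI_p$ of probability vectors $p$ on the classes with $\|p-\hat p\|_1\le\varepsilon_p$. Let $\mathcal M\in\mathcal C$ have optimistic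 class probabilities: for every $s<S$ and every class $i$, $p(s)$ maximizes $\sum_{j:\,r^{(j)}(s)\ge r^{(i)}(s)}q^{(j)}$ over $q\in CI_p$. A (deterministic stationary) policy $\pi$ admits in state $s<S$ the set of classes $\pi(s)$, and no job in state $S$. Let $\Lambda^\pi(s)$ and $R^\pi(s)$ be the sums over the admitted classes of $\lambda^{(i)}(s)$ and $\lambda^{(i)}(s)r^{(i)}(s)$, and let $Z^\pi$ be the generator of the birth-and-death process $(s_t)$ with birth rates $\Lambda^\pi(s)$ and death rates $\mu(s)$. The average reward is $\rho^\pi=\lim_{T\to\infty}\frac1T\mathbb E\int_0^T R^\pi(s_t)\,dt$, from any initial state; a bias is a vector $h^\pi$ with $\rho^\pi=R^\pi(s)+(Z^\pi h^\pi)(s)$ for all $s$; and $\nabla h^\pi(s)=h^\pi(s)-h^\pi(s+1)$ for $0\le s<S$. The policy $\pi$ is gain optimal if $\rho^{\pi'}\le\rho^\pi$ for every policy $\pi'$. It satisfies the Bellman equation if, for all $s$, $$\rho^\pi=\max_{a}\sum_{i\in a}\lambda^{(i)}(s)\bigl(r^{(i)}(s)-\nabla h^\pi(s)\bigr)+\mu(s)\nabla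 h^\pi(s-1),$$ where $a$ ranges over the sets of classes if $s<S$, and $a=\emptyset$ if $s=S$. **Theorem.** For every policy $\pi$, the average reward $\rho^\pi$ (independent of the initial state) and a bias $h^\pi$ exist. Moreover: (i) For every policy $\pi$, $\ \rho^\pi\le\sum_i\lambda^{(i)}(0)R^{(i)}\le\Lambda_{\max}R_{\max}$. (ii) Suppose that $\lambda^{(i)}(0)R^{(i)}>0$ for some class $i$, and let $\pi$ be gain optimal. Then $$0<\nabla h^\pi(s)\le\frac{\rho^\pi}{\mu_{\max}}\le\frac{\Lambda_{\max}R_{\max}}{\mu_{\max}}$$ for every $s<S$ such that $s+1$ is recurrent under $\pi$; and for every $s<S$ if $\pi$ satisfies the Bellman equation. -/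

import Mathlib

open MeasureTheory Filter Topology

/-- Law of the time `W(s)` that a job admitted when `s` jobs are present waits for a free server:
`0` if a server is free (`s < c`), and Erlang with shape `s - c + 1` and rate `c * μ` otherwise. -/
noncomputable def waitLaw (c : ℕ) (μ : ℝ) (s : ℕ) : Measure ℝ :=
  if s < c then Measure.dirac 0
  else ProbabilityTheory.gammaMeasure ((s - c + 1 : ℕ) : ℝ) ((c : ℝ) * μ)

/-- An M/M/c/S queue with `m` job classes. The cost functions are used on `[0, ∞)` only, where they
are nondecreasing and start at `0`, hence nonnegative. -/
structure AdmissionQueue (m S : ℕ) where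
  servers : ℕ
  servers_pos : 0 < servers
  mu : ℝ
  mu_pos : 0 < mu
  /-- the immediate reward `R⁽ⁱ⁾` -/
  reward : Fin m → ℝ
  reward_nonneg : ∀ i, 0 ≤ reward i
  /-- the holding cost `C⁽ⁱ⁾(t)` of a waiting time `t` -/
  cost : Fin m → ℝ → ℝ
  cost_zero : ∀ i, cost i 0 = 0
  cost_mono : ∀ i, MonotoneOn (cost i) (Set.Ici 0)
  /-- the expected holding cost of an admissible job is finite -/
  cost_integrable : ∀ i, ∀ s < S, Integrable (cost i) (waitLaw servers mu s)

namespace AdmissionQueue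

variable {m S : ℕ}

/-- `μ(s) = min(s, c) μ` -/
noncomputable def serviceRate (Q : AdmissionQueue m S) (s : ℕ) : ℝ :=
  (min s Q.servers : ℕ) * Q.mu

/-- `μ_max = μ(S)` -/
noncomputable def serviceRateMax (Q : AdmissionQueue m S) : ℝ := Q.serviceRate S

/-- `r⁽ⁱ⁾(s) = R⁽ⁱ⁾ - E[C⁽ⁱ⁾(W(s))]` -/
noncomputable def expectedReward (Q : AdmissionQueue m S) (i : Fin m) (s : ℕ) : ℝ :=
  Q.reward i - ∫ t, Q.cost i t ∂(waitLaw Q.servers Q.mu s)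

end AdmissionQueue

/-- State-dependent arrivals: a global arrival rate `Λ` and, in each state `s ∈ {0, …, S}`,
class probabilities `p⁽ⁱ⁾(s)`. -/
structure ArrivalModel (m S : ℕ) where
  totalRate : ℝ
  prob : Fin (S + 1) → Fin m → ℝ

/-- `λ⁽ⁱ⁾(s) = Λ p⁽ⁱ⁾(s)` -/
def ArrivalModel.rate {m S : ℕ} (M : ArrivalModel m S) (s : Fin (S + 1)) (i : Fin m) : ℝ :=
  M.totalRate * M.prob s i

/-- Data of a confidence set: a priori bounds for `Λ`, and centre and radius of the confidence
regions for `Λ` and for the class probabilities. -/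
structure ConfidenceSet (m : ℕ) where
  rateMin : ℝ
  rateMax : ℝ
  rateMin_pos : 0 < rateMin
  rateHat : ℝ
  rateRadius : ℝ
  probHat : Fin m → ℝ
  probRadius : ℝ

namespace ConfidenceSet

variable {m S : ℕ}

/-- The confidence interval `[Λ̂ - ε_Λ, Λ̂ + ε_Λ] ∩ [Λ_min, Λ_max]`. -/
def rateInterval (K : ConfidenceSet m) : Set ℝ :=
  Set.Icc (K.rateHat - K.rateRadius) (K.rateHat + K.rateRadius) ∩ Set.Icc K.rateMin K.rateMax

/-- The probability vectors at `ℓ¹` distance at most `ε_p` from `p̂`. -/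
def probRegion (K : ConfidenceSet m) : Set (Fin m → ℝ) :=
  {p | p ∈ stdSimplex ℝ (Fin m) ∧ ∑ i, |p i - K.probHat i| ≤ K.probRadius}

/-- `M` belongs to the confidence set. -/
def Contains (K : ConfidenceSet m) (M : ArrivalModel m S) : Prop :=
  M.totalRate ∈ K.rateInterval ∧ ∀ s, M.prob s ∈ K.probRegion

/-- The class probabilities of `M` are optimistic: in every state `s < S`, for every class `i`, the
total probability of the classes with priority at least that of `i` (with respect to `r⁽·⁾(s)`)
is maximal in the confidence region. -/
def IsOptimistic (K : ConfidenceSet m) (Q : AdmissionQueue m S) (M : ArrivalModel m S) : Prop :=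
  ∀ s : Fin S, ∀ i : Fin m, ∀ q ∈ K.probRegion,
    ∑ j with Q.expectedReward i s ≤ Q.expectedReward j s, q j ≤
      ∑ j with Q.expectedReward i s ≤ Q.expectedReward j s, M.prob s.castSucc j

end ConfidenceSet

/-- Deterministic stationary policies: `π s` is the set of classes admitted in state `s`. -/
abbrev Policy (m S : ℕ) : Type := Fin (S + 1) → Finset (Fin m)

section Chain

variable {m S : ℕ}

/-- The classes effectively admitted: none when the queue is full. -/
def accepted (π : Policy m S) (s : Fin (S + 1)) : Finset (Fin m) :=
  if (s : ℕ) < S then π s else ∅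

/-- `Λ^π(s)` -/
noncomputable def birthRate (M : ArrivalModel m S) (π : Policy m S) (s : Fin (S + 1)) : ℝ :=
  ∑ i ∈ accepted π s, M.rate s i

/-- `R^π(s)`, the expected reward per unit of time -/
noncomputable def rewardRate (Q : AdmissionQueue m S) (M : ArrivalModel m S) (π : Policy m S)
    (s : Fin (S + 1)) : ℝ :=
  ∑ i ∈ accepted π s, M.rate s i * Q.expectedReward i s

/-- The infinitesimal generator `Z^π` of the birth-and-death process. -/
noncomputable def generator (Q : AdmissionQueue m S) (M : ArrivalModel m S) (π : Policy m S) :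
    Matrix (Fin (S + 1)) (Fin (S + 1)) ℝ :=
  fun s t =>
    if (t : ℕ) = s + 1 then birthRate M π s
    else if (s : ℕ) = t + 1 then Q.serviceRate s
    else if s = t then -(birthRate M π s + Q.serviceRate s)
    else 0

/-- `ρ` is the long-run average reward `lim_{T → ∞} (1/T) E[∫₀ᵀ R^π(s_t) dt]`, from every initial
state. The transition matrix of the chain over a time `t` is `exp (t Z^π)`, so that
`E[R^π(s_t) | s_0 = s] = (exp (t Z^π) R^π)(s)`. -/
def IsAverageReward (Q : AdmissionQueue m S) (M : ArrivalModel m S) (π : Policy m S)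
    (ρ : ℝ) : Prop :=
  ∀ s : Fin (S + 1), Tendsto
    (fun T : ℝ => (1 / T) * ∫ t in (0 : ℝ)..T,
      (NormedSpace.exp (t • generator Q M π)).mulVec (rewardRate Q M π) s)
    atTop (𝓝 ρ)

/-- `h` is a bias vector for the average reward `ρ`: `ρ = R^π + Z^π h`
(this determines `h` up to an additive constant). -/
def IsBias (Q : AdmissionQueue m S) (M : ArrivalModel m S) (π : Policy m S)
    (ρ : ℝ) (h : Fin (S + 1) → ℝ) : Prop :=
  ∀ s, ρ = rewardRate Q M π s + (generator Q M π).mulVec h s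

/-- The relative bias `∇h(s) = h(s) - h(s + 1)`, for `0 ≤ s < S`. -/
def relativeBias (h : Fin (S + 1) → ℝ) (s : Fin S) : ℝ := h s.castSucc - h s.succ

/-- `π` has the largest average reward among all policies. -/
def IsGainOptimal (Q : AdmissionQueue m S) (M : ArrivalModel m S) (π : Policy m S) : Prop :=
  ∃ ρ, IsAverageReward Q M π ρ ∧ ∀ π' ρ', IsAverageReward Q M π' ρ' → ρ' ≤ ρ

/-- The Bellman equation: for every state `s`, `ρ` is the maximum over the actions `a` of
`∑_{i ∈ a} λ⁽ⁱ⁾(s) (r⁽ⁱ⁾(s) - ∇h(s)) + μ(s) ∇h(s - 1)` (with nobody admitted in state `S`).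
Row `s` of `R^π + Z^π h` depends on `π s` only, so a constant policy stands for the action. -/
def SatisfiesBellman (Q : AdmissionQueue m S) (M : ArrivalModel m S)
    (ρ : ℝ) (h : Fin (S + 1) → ℝ) : Prop :=
  ∀ s, IsGreatest (Set.range fun a : Finset (Fin m) =>
    rewardRate Q M (fun _ => a) s + (generator Q M (fun _ => a)).mulVec h s) ρ

/-- `s` is recurrent for the (finite) chain induced by `π`: every state that can be reached from
`s` through transitions of positive rate leads back to `s`. -/
def IsRecurrentState (Q : AdmissionQueue m S) (M : ArrivalModel m S) (π : Policy m S)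
    (s : Fin (S + 1)) : Prop :=
  ∀ t, Relation.ReflTransGen (fun x y => 0 < generator Q M π x y) s t →
    Relation.ReflTransGen (fun x y => 0 < generator Q M π x y) t s

end Chain

/-! Only the differences `x s = ∇h(s)` matter: the bias equation reads `ρ = R(s) - Λ(s) x(s) + μ(s)
x(s-1)`, a recursion that can be solved downwards from `s = S`. Any solution yields the average
reward, because `exp (t Z) h` stays bounded for `t ≥ 0` and has derivative `ρ - exp (t Z) R`. Where
`h` is maximal, `Z h ≤ 0`, hence `ρ ≤ R(s)`; this gives (i).

Maximizing over actions turns the equation into `ρ = G_s(x(s)) + μ(s) x(s-1)` with `G_s(y) = ∑ λ(s)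
(r(s) - y)⁺` (`netRewardRate`), nonnegative and nonincreasing in `y`. It is also nonincreasing in `s
< S`: Erlang waits grow stochastically with `s`, so rewards fall, and optimistic probabilities are
the best ones for weights that increase with the priority (`netRewardRate_le_of_isOptimistic`).
While servers are free, `G_s` does not depend on `s` and `μ(s)` increases strictly; afterwards
`μ(s)` is constant. These facts force `x` to be positive and nondecreasing
(`bellman_differences_bounds`), so that `x(s) ≤ x(S-1) = ρ / μ_max`.

A gain optimal policy may violate the Bellman equation because of its transient states. Let `k` be
its first state of zero birth rate; recurrent states are at most `k`. Setting `x(n) = ρ / μ(n+1)`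
for `n ≥ k` makes rejection neutral above `k`, and policy improvement then yields the optimality
equation up to `k`, so the previous argument applies with capacity `k`. Finally `μ(k) = μ_max`,
since `k < S` with a free server in state `k` is impossible (`false_of_reject_all_of_free_server`).
-/

/-! ### Semigroups of Markov generators and their time averages. -/

section MatrixExp

open Matrix

attribute [local instance] Matrix.linftyOpNormedRing Matrix.linftyOpNormedAlgebra
  Matrix.linftyOpNormedAddCommGroup

variable {n : Type*} [Fintype n] [DecidableEq n]

theorem NormedSpace.norm_exp_le_exp_norm {A : Type*} [NormedRing A] [NormedAlgebra ℝ A]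
    [Algebra ℚ A] [CompleteSpace A] [NormOneClass A] (x : A) :
    ‖NormedSpace.exp x‖ ≤ Real.exp ‖x‖ := by
  rw [NormedSpace.exp_eq_tsum ℝ]
  have h2 := NormedSpace.exp_series_hasSum_exp' (𝕂 := ℝ) ‖x‖
  rw [← Real.exp_eq_exp_ℝ] at h2
  refine tsum_of_norm_bounded h2 fun k => ?_
  rw [norm_smul, smul_eq_mul, Real.norm_of_nonneg (by positivity)]
  gcongr
  exact norm_pow_le x k

/-- Uniformization: for large `c` the matrix `N = t (Z + c)` is entrywise nonnegative with row sums
`t c`, so `‖exp N‖ ≤ exp (t c)`, and `exp (t Z) = exp (-t c) exp N`. -/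
theorem Matrix.norm_exp_smul_le_one [Nonempty n] (Z : Matrix n n ℝ)
    (hoff : ∀ i j, i ≠ j → 0 ≤ Z i j) (hrow : ∀ i, ∑ j, Z i j = 0) {t : ℝ} (ht : 0 ≤ t) :
    ‖NormedSpace.exp (t • Z)‖ ≤ 1 := by
  set c : ℝ := ∑ i, |Z i i| with hc
  have hci : ∀ i, 0 ≤ Z i i + c := fun i => by
    have : |Z i i| ≤ c := Finset.single_le_sum (f := fun i => |Z i i|)
      (fun _ _ => abs_nonneg _) (Finset.mem_univ i)
    linarith [neg_abs_le (Z i i)]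
  have hc0 : 0 ≤ c := Finset.sum_nonneg fun _ _ => abs_nonneg _
  set N : Matrix n n ℝ := t • (Z + c • 1) with hN
  have hnn : ∀ i j, 0 ≤ N i j := fun i j => by
    by_cases h : i = j
    · subst h; simpa [hN, mul_add] using mul_nonneg ht (hci i)
    · simpa [hN, Matrix.one_apply_ne h] using mul_nonneg ht (hoff i j h)
  have hNn : ‖N‖ ≤ t * c := by
    rw [Matrix.linfty_opNorm_def]
    refine (NNReal.coe_le_coe (r₂ := ⟨t * c, by positivity⟩)).2 (Finset.sup_le fun i _ => ?_)
    refine NNReal.coe_le_coe.1 ?_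
    rw [NNReal.coe_sum]
    simp_rw [coe_nnnorm]
    change _ ≤ t * c
    have : ∀ j, ‖N i j‖ = t * Z i j + t * c * (1 : Matrix n n ℝ) i j := fun j => by
      rw [Real.norm_of_nonneg (hnn i j)]; simp [hN]; ring
    simp_rw [this, Finset.sum_add_distrib, ← Finset.mul_sum, hrow]
    simp [Matrix.one_apply]
  have hsplit : t • Z = N + algebraMap ℝ (Matrix n n ℝ) (-(t * c)) := by
    rw [hN, Algebra.algebraMap_eq_smul_one]
    module
  have hcomm : Commute N (algebraMap ℝ (Matrix n n ℝ) (-(t * c))) :=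
    (Algebra.commutes _ _).symm
  have hexp : NormedSpace.exp (algebraMap ℝ (Matrix n n ℝ) (-(t * c))) =
      algebraMap ℝ (Matrix n n ℝ) (Real.exp (-(t * c))) := by
    rw [Real.exp_eq_exp_ℝ]
    exact (NormedSpace.algebraMap_exp_comm (𝕂 := ℝ) (𝔸 := Matrix n n ℝ) (-(t * c))).symm
  rw [hsplit, Matrix.exp_add_of_commute _ _ hcomm, hexp]
  calc _ ≤ ‖NormedSpace.exp N‖ * ‖algebraMap ℝ (Matrix n n ℝ) (Real.exp (-(t * c)))‖ :=
        norm_mul_le _ _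
    _ ≤ Real.exp (t * c) * Real.exp (-(t * c)) := by
        gcongr
        · exact (NormedSpace.norm_exp_le_exp_norm N).trans (Real.exp_le_exp.2 hNn)
        · rw [norm_algebraMap', Real.norm_of_nonneg (Real.exp_pos _).le]
    _ = 1 := by rw [← Real.exp_add]; simp

theorem Matrix.hasDerivAt_exp_smul_mulVec (Z : Matrix n n ℝ) (v : n → ℝ) (i : n) (t : ℝ) :
    HasDerivAt (fun t : ℝ => (NormedSpace.exp (t • Z)).mulVec v i)
      ((NormedSpace.exp (t • Z)).mulVec (Z.mulVec v) i) t := by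
  have h := hasDerivAt_exp_smul_const (𝕂 := ℝ) Z t
  let f : Matrix n n ℝ →ₗ[ℝ] ℝ :=
    { toFun := fun A => A.mulVec v i
      map_add' := fun A B => by simp [Matrix.add_mulVec]
      map_smul' := fun a A => by simp [Matrix.smul_mulVec] }
  have h2 := (LinearMap.toContinuousLinearMap f).hasFDerivAt.comp_hasDerivAt t h
  rw [Matrix.mulVec_mulVec]
  exact h2

/-- The time averages of `exp (t Z) r` converge to `ρ` as soon as `ρ = r + Z h` for some `h`. -/
theorem Matrix.tendsto_average_exp_mulVec [Nonempty n] (Z : Matrix n n ℝ)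
    (hoff : ∀ i j, i ≠ j → 0 ≤ Z i j) (hrow : ∀ i, ∑ j, Z i j = 0) (r h : n → ℝ) (ρ : ℝ)
    (hρ : ∀ i, ρ = r i + Z.mulVec h i) (i : n) :
    Tendsto (fun T : ℝ => (1 / T) * ∫ t in (0 : ℝ)..T,
      (NormedSpace.exp (t • Z)).mulVec r i) atTop (𝓝 ρ) := by
  have hone : Z.mulVec 1 = 0 := by
    ext j; simpa [Matrix.mulVec, dotProduct] using hrow j
  have hr : r = ρ • (1 : n → ℝ) - Z.mulVec h := by
    ext j; simp; linarith [hρ j]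
  have hexp1 : ∀ t : ℝ, (NormedSpace.exp (t • Z)).mulVec 1 i = 1 := fun t => by
    have hd : ∀ t : ℝ, HasDerivAt (fun t : ℝ => (NormedSpace.exp (t • Z)).mulVec 1 i) 0 t :=
      fun t => by simpa [hone] using Matrix.hasDerivAt_exp_smul_mulVec Z 1 i t
    have := is_const_of_deriv_eq_zero (fun t => (hd t).differentiableAt)
      (fun t => (hd t).deriv) t 0
    simpa using this
  -- As `Z 1 = 0`, the semigroup fixes constants, so the integrand is the derivative of `t ρ - exp
  -- (t Z) h`.
  have hint : ∀ T : ℝ, ∫ t in (0 : ℝ)..T, (NormedSpace.exp (t • Z)).mulVec r i =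
      T * ρ - ((NormedSpace.exp (T • Z)).mulVec h i - h i) := fun T => by
    have hd : ∀ t : ℝ, HasDerivAt
        (fun t : ℝ => t * ρ - (NormedSpace.exp (t • Z)).mulVec h i)
        ((NormedSpace.exp (t • Z)).mulVec r i) t := fun t => by
      have h1 := ((hasDerivAt_id t).mul_const ρ).sub (Matrix.hasDerivAt_exp_smul_mulVec Z h i t)
      have h2 : (NormedSpace.exp (t • Z)).mulVec r i =
          1 * ρ - (NormedSpace.exp (t • Z)).mulVec (Z.mulVec h) i := by
        rw [hr, Matrix.mulVec_sub, Matrix.mulVec_smul]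
        simp [hexp1 t]
      rw [h2]
      exact h1
    rw [intervalIntegral.integral_eq_sub_of_hasDerivAt (fun t _ => hd t)]
    · simp; ring
    · apply Continuous.intervalIntegrable
      exact continuous_iff_continuousAt.2 fun t =>
        (Matrix.hasDerivAt_exp_smul_mulVec Z r i t).continuousAt
  have hlim : Tendsto (fun T : ℝ => (1 / T) * ((NormedSpace.exp (T • Z)).mulVec h i - h i))
      atTop (𝓝 0) := by
    have h0 : Tendsto (fun T : ℝ => (1 / T) * (2 * ‖h‖)) atTop (𝓝 0) := by
      simpa using (tendsto_inv_atTop_zero (𝕜 := ℝ)).mul_const (2 * ‖h‖)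
    refine squeeze_zero_norm' ?_ h0
    filter_upwards [eventually_gt_atTop 0] with T hT
    rw [norm_mul, Real.norm_of_nonneg (by positivity)]
    gcongr
    have h1 : ‖(NormedSpace.exp (T • Z)).mulVec h i‖ ≤ 1 * ‖h‖ :=
      (norm_le_pi_norm _ i).trans ((Matrix.linfty_opNorm_mulVec _ _).trans (by
        gcongr; exact Matrix.norm_exp_smul_le_one Z hoff hrow hT.le))
    have h2 := norm_le_pi_norm h i
    have h3 := norm_sub_le ((NormedSpace.exp (T • Z)).mulVec h i) (h i)
    linarith
  have := (tendsto_const_nhds (x := ρ)).sub hlim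
  rw [sub_zero] at this
  refine this.congr' ?_
  filter_upwards [eventually_gt_atTop 0] with T hT
  rw [hint]
  field_simp

end MatrixExp

/-! ### The bias equation of the birth-and-death process. -/

section BirthDeath

variable {m S : ℕ}

theorem AdmissionQueue.serviceRate_zero (Q : AdmissionQueue m S) : Q.serviceRate 0 = 0 := by
  simp [AdmissionQueue.serviceRate]

theorem AdmissionQueue.serviceRate_nonneg (Q : AdmissionQueue m S) (s : ℕ) :
    0 ≤ Q.serviceRate s :=
  mul_nonneg (Nat.cast_nonneg _) Q.mu_pos.le

theorem AdmissionQueue.serviceRate_pos (Q : AdmissionQueue m S) {s : ℕ} (hs : 0 < s) :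
    0 < Q.serviceRate s :=
  mul_pos (Nat.cast_pos.2 (lt_min hs Q.servers_pos)) Q.mu_pos

theorem AdmissionQueue.serviceRate_of_le (Q : AdmissionQueue m S) {s : ℕ}
    (hs : Q.servers ≤ s) : Q.serviceRate s = Q.servers * Q.mu := by
  simp [AdmissionQueue.serviceRate, hs]

theorem AdmissionQueue.serviceRate_lt_succ (Q : AdmissionQueue m S) {s : ℕ}
    (hs : s < Q.servers) : Q.serviceRate s < Q.serviceRate (s + 1) := by
  unfold AdmissionQueue.serviceRate
  rw [min_eq_left hs.le, min_eq_left hs]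
  exact mul_lt_mul_of_pos_right (Nat.cast_lt.2 s.lt_succ_self) Q.mu_pos

theorem accepted_eq_empty {π : Policy m S} {s : Fin (S + 1)} (hs : (s : ℕ) = S) :
    accepted π s = ∅ := by
  simp [accepted, hs]

theorem birthRate_eq_zero {M : ArrivalModel m S} {π : Policy m S} {s : Fin (S + 1)}
    (hs : (s : ℕ) = S) : birthRate M π s = 0 := by
  simp [birthRate, accepted_eq_empty hs]

theorem rewardRate_eq_zero {Q : AdmissionQueue m S} {M : ArrivalModel m S} {π : Policy m S}
    {s : Fin (S + 1)} (hs : (s : ℕ) = S) : rewardRate Q M π s = 0 := by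
  simp [rewardRate, accepted_eq_empty hs]

theorem birthRate_nonneg {M : ArrivalModel m S} (hM : ∀ s i, 0 ≤ M.rate s i) (π : Policy m S)
    (s : Fin (S + 1)) : 0 ≤ birthRate M π s :=
  Finset.sum_nonneg fun _ _ => hM s _

/-- The relative bias, extended by zero to all natural numbers. -/
noncomputable def relativeBiasExt (h : Fin (S + 1) → ℝ) (n : ℕ) : ℝ :=
  if hn : n < S then relativeBias h ⟨n, hn⟩ else 0

theorem relativeBiasExt_val (h : Fin (S + 1) → ℝ) (s : Fin S) :
    relativeBiasExt h s = relativeBias h s := by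
  simp [relativeBiasExt]

/-- One formula serves all states: at `s = 0` the truncated index `s - 1` is multiplied by `μ(0) =
0`, and at `s = S` the default value of the extension by a zero birth rate. -/
theorem generator_mulVec (Q : AdmissionQueue m S) (M : ArrivalModel m S) (π : Policy m S)
    (h : Fin (S + 1) → ℝ) (s : Fin (S + 1)) :
    (generator Q M π).mulVec h s =
      -(birthRate M π s * relativeBiasExt h s) +
        Q.serviceRate s * relativeBiasExt h ((s : ℕ) - 1) := by
  set H : ℕ → ℝ := fun n => if hn : n < S + 1 then h ⟨n, hn⟩ else 0 with hH
  have hHv : ∀ t : Fin (S + 1), H t = h t := fun t => dif_pos t.2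
  have hx : ∀ n < S, relativeBiasExt h n = H n - H (n + 1) := fun n hn => by
    rw [relativeBiasExt, dif_pos hn, hH]
    simp only
    rw [dif_pos (by omega), dif_pos (by omega)]
    rfl
  -- At `s = 0` the last two indicators pick the same index, harmlessly since the last coefficient
  -- is then zero.
  let F : ℕ → ℝ := fun n => ((if n = s + 1 then birthRate M π s * H n else 0) -
    (if n = s then (birthRate M π s + Q.serviceRate s) * H n else 0)) +
    (if n = (s : ℕ) - 1 then Q.serviceRate s * H n else 0)
  have e1 : ∀ t : Fin (S + 1), generator Q M π s t * h t = F t := fun t => by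
    simp only [F, generator, hHv, Fin.ext_iff, @eq_comm ℕ s t]
    by_cases h1 : (t : ℕ) = s + 1
    · have : ¬ (t : ℕ) = s := by omega
      have h3 : ¬ (t : ℕ) = s - 1 := by omega
      simp [h1]
      omega
    · by_cases h2 : (s : ℕ) = t + 1
      · have : ¬ (t : ℕ) = s := by omega
        have h3 : (t : ℕ) = s - 1 := by omega
        rw [if_neg h1, if_pos h2, if_neg h1, if_neg this, if_pos h3]; ring
      · by_cases h3 : (t : ℕ) = s
        · rw [if_neg h1, if_neg h2, if_pos h3, if_neg h1, if_pos h3]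
          split_ifs with h4
          · have : (s : ℕ) = 0 := by omega
            rw [this, Q.serviceRate_zero]; ring
          · ring
        · have : ¬ (t : ℕ) = s - 1 := by omega
          rw [if_neg h1, if_neg h2, if_neg h3, if_neg h1, if_neg h3, if_neg this]; ring
  rw [Matrix.mulVec, dotProduct, Finset.sum_congr rfl fun t _ => e1 t,
    ← Finset.sum_range F, Finset.sum_add_distrib, Finset.sum_sub_distrib, Finset.sum_ite_eq',
    Finset.sum_ite_eq', Finset.sum_ite_eq']
  have hs := s.2
  rw [if_pos (Finset.mem_range.2 hs), if_pos (Finset.mem_range.2 (by omega : (s : ℕ) - 1 < S + 1))]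
  have hd : Q.serviceRate s * relativeBiasExt h ((s : ℕ) - 1) =
      Q.serviceRate s * (H ((s : ℕ) - 1) - H s) := by
    rcases Nat.eq_zero_or_pos (s : ℕ) with h0 | h0
    · rw [h0, Q.serviceRate_zero]; ring
    · rw [hx _ (by omega), Nat.sub_add_cancel h0]
  rw [hd]
  by_cases hS : (s : ℕ) < S
  · rw [if_pos (Finset.mem_range.2 (by omega)), hx _ hS]; ring
  · rw [birthRate_eq_zero (by omega)]; simp; ring

theorem isBias_iff (Q : AdmissionQueue m S) (M : ArrivalModel m S) (π : Policy m S) (ρ : ℝ)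
    (h : Fin (S + 1) → ℝ) :
    IsBias Q M π ρ h ↔ ∀ s : Fin (S + 1), ρ = rewardRate Q M π s -
      birthRate M π s * relativeBiasExt h s +
        Q.serviceRate s * relativeBiasExt h ((s : ℕ) - 1) := by
  unfold IsBias
  refine forall_congr' fun s => ?_
  rw [generator_mulVec]
  constructor <;> intro h <;> linarith

theorem generator_row_sum (Q : AdmissionQueue m S) (M : ArrivalModel m S) (π : Policy m S)
    (s : Fin (S + 1)) : ∑ t, generator Q M π s t = 0 := by
  have := generator_mulVec Q M π (fun _ => 1) s
  simpa [Matrix.mulVec, dotProduct, relativeBiasExt, relativeBias] using this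

theorem generator_offDiag_nonneg (Q : AdmissionQueue m S) {M : ArrivalModel m S}
    (hM : ∀ s i, 0 ≤ M.rate s i) (π : Policy m S) {s t : Fin (S + 1)} (hst : s ≠ t) :
    0 ≤ generator Q M π s t := by
  unfold generator
  split_ifs
  · exact birthRate_nonneg hM π s
  · exact Q.serviceRate_nonneg s
  · exact le_rfl

theorem IsBias.isAverageReward {Q : AdmissionQueue m S} {M : ArrivalModel m S}
    (hM : ∀ s i, 0 ≤ M.rate s i) {π : Policy m S} {ρ : ℝ} {h : Fin (S + 1) → ℝ}
    (hb : IsBias Q M π ρ h) : IsAverageReward Q M π ρ := fun s =>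
  Matrix.tendsto_average_exp_mulVec _ (fun _ _ hst => generator_offDiag_nonneg Q hM π hst)
    (generator_row_sum Q M π) _ h ρ hb s

theorem IsAverageReward.unique {Q : AdmissionQueue m S} {M : ArrivalModel m S} {π : Policy m S}
    {ρ ρ' : ℝ} (h : IsAverageReward Q M π ρ) (h' : IsAverageReward Q M π ρ') : ρ = ρ' :=
  tendsto_nhds_unique (h 0) (h' 0)

/-- Solving downwards from `x(S) = 0` gives each `x(s)` as an affine function of the unknown `ρ`;
the equation in state `0` then determines `ρ`, its coefficient being at least `1`. -/
theorem exists_isBias (Q : AdmissionQueue m S) {M : ArrivalModel m S}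
    (hM : ∀ s i, 0 ≤ M.rate s i) (π : Policy m S) : ∃ ρ h, IsBias Q M π ρ h := by
  set L : ℕ → ℝ := fun n => if hn : n < S + 1 then birthRate M π ⟨n, hn⟩ else 0 with hL
  set R : ℕ → ℝ := fun n => if hn : n < S + 1 then rewardRate Q M π ⟨n, hn⟩ else 0 with hR
  have hL0 : ∀ n, 0 ≤ L n := fun n => by
    simp only [hL]; split_ifs
    · exact birthRate_nonneg hM _ _
    · exact le_rfl
  -- `x(S - j) = A j * ρ + B j`, by `x(s-1) = (ρ - R(s) + Λ(s) x(s)) / μ(s)` at `s = S - j`.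
  let A : ℕ → ℝ := fun j => Nat.rec 0 (fun j a => (1 + L (S - j) * a) / Q.serviceRate (S - j)) j
  let B : ℕ → ℝ := fun j =>
    Nat.rec 0 (fun j b => (-R (S - j) + L (S - j) * b) / Q.serviceRate (S - j)) j
  have hA0 : ∀ j, 0 ≤ A j := fun j => by
    induction j with
    | zero => exact le_rfl
    | succ j ih =>
      exact div_nonneg (add_nonneg zero_le_one (mul_nonneg (hL0 _) ih)) (Q.serviceRate_nonneg _)
  set ρ : ℝ := (R 0 - L 0 * B S) / (1 + L 0 * A S) with hρ
  set x : ℕ → ℝ := fun s => A (S - s) * ρ + B (S - s) with hx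
  set h : Fin (S + 1) → ℝ := fun s => -∑ j ∈ Finset.range s, x j with hh
  have hxe : ∀ n ≤ S, relativeBiasExt h n = x n := fun n hn => by
    rcases hn.lt_or_eq with hn | rfl
    · simp [relativeBiasExt, hn, relativeBias, hh, Finset.sum_range_succ]
    · simp [relativeBiasExt, hx, A, B]
  refine ⟨ρ, h, (isBias_iff ..).2 fun s => ?_⟩
  have hLs : birthRate M π s = L s := by simp only [hL]; rw [dif_pos s.2]
  have hRs : rewardRate Q M π s = R s := by simp only [hR]; rw [dif_pos s.2]
  have hs := s.2
  rw [hxe _ (by omega), hxe _ (by omega), hLs, hRs]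
  generalize (s : ℕ) = k at hs
  rcases k with _ | k
  · have hpos : 0 < 1 + L 0 * A S := by have := mul_nonneg (hL0 0) (hA0 S); linarith
    have : ρ * (1 + L 0 * A S) = R 0 - L 0 * B S := by rw [hρ]; field_simp
    simp only [hx, Q.serviceRate_zero, Nat.sub_zero]
    linarith
  · have hμ := Q.serviceRate_pos k.succ_pos
    have hj : S - k = (S - (k + 1)) + 1 := by omega
    have hk : S - (S - (k + 1)) = k + 1 := by omega
    have eA : A (S - k) = (1 + L (k + 1) * A (S - (k + 1))) / Q.serviceRate (k + 1) := by
      rw [hj]; simp only [A]; rw [hk]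
    have eB : B (S - k) =
        (-R (k + 1) + L (k + 1) * B (S - (k + 1))) / Q.serviceRate (k + 1) := by
      rw [hj]; simp only [B]; rw [hk]
    simp only [hx, Nat.add_sub_cancel, eA, eB]
    have := hμ.ne'
    field_simp
    ring

/-- Maximum principle: where `h` is largest, the generator applied to `h` is nonpositive. -/
theorem IsBias.exists_le_rewardRate {Q : AdmissionQueue m S} {M : ArrivalModel m S}
    (hM : ∀ s i, 0 ≤ M.rate s i) {π : Policy m S} {ρ : ℝ} {h : Fin (S + 1) → ℝ}
    (hb : IsBias Q M π ρ h) : ∃ s, ρ ≤ rewardRate Q M π s := by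
  obtain ⟨s, hs⟩ := Finite.exists_max h
  refine ⟨s, ?_⟩
  rw [hb s, add_le_iff_nonpos_right]
  calc (generator Q M π).mulVec h s = ∑ t, generator Q M π s t * (h t - h s) := by
        simp_rw [mul_sub, Finset.sum_sub_distrib, ← Finset.sum_mul, generator_row_sum]
        simp [Matrix.mulVec, dotProduct]
    _ ≤ 0 := Finset.sum_nonpos fun t _ => by
        by_cases hst : s = t
        · simp [hst]
        · exact mul_nonpos_of_nonneg_of_nonpos (generator_offDiag_nonneg Q hM π hst)
            (sub_nonpos.2 (hs t))

end BirthDeath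

/-! ### Stochastic monotonicity of gamma laws in the shape. -/

section Gamma

open ProbabilityTheory

theorem integrable_gammaMeasure_iff {a b : ℝ} (ha : 0 < a) (hb : 0 < b) {f : ℝ → ℝ} :
    Integrable f (gammaMeasure a b) ↔ Integrable (fun t => gammaPDFReal a b t * f t) := by
  unfold gammaMeasure
  rw [integrable_withDensity_iff_integrable_smul' (f := gammaPDF a b)
    (measurable_gammaPDFReal a b).ennreal_ofReal (ae_of_all _ fun _ => ENNReal.ofReal_lt_top)]
  simp [gammaPDF, ENNReal.toReal_ofReal (gammaPDFReal_nonneg ha hb _)]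

theorem integral_gammaMeasure {a b : ℝ} (ha : 0 < a) (hb : 0 < b) (f : ℝ → ℝ) :
    ∫ t, f t ∂(gammaMeasure a b) = ∫ t, gammaPDFReal a b t * f t := by
  unfold gammaMeasure
  rw [integral_withDensity_eq_integral_toReal_smul (f := gammaPDF a b)
    (measurable_gammaPDFReal a b).ennreal_ofReal (ae_of_all _ fun _ => ENNReal.ofReal_lt_top)]
  simp [gammaPDF, ENNReal.toReal_ofReal (gammaPDFReal_nonneg ha hb _)]

theorem gammaPDFReal_add_one {a b t : ℝ} (ha : 0 < a) (hb : 0 < b) :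
    gammaPDFReal (a + 1) b t = gammaPDFReal a b t * (b * t / a) := by
  unfold gammaPDFReal
  split_ifs with ht
  · rcases ht.eq_or_lt with rfl | ht
    · simp [Real.zero_rpow ha.ne']
    · rw [Real.Gamma_add_one ha.ne', Real.rpow_add_one hb.ne', add_sub_cancel_right,
        show t ^ a = t ^ (a - 1) * t by rw [← Real.rpow_add_one ht.ne']; simp]
      have := (Real.Gamma_pos_of_pos ha).ne'
      field_simp
  · simp

/-- The expectation of a monotone function of a gamma variable increases with the shape. -/
theorem integral_gammaMeasure_le_add_one {a b : ℝ} (ha : 0 < a) (hb : 0 < b) {f : ℝ → ℝ}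
    (hf : MonotoneOn f (Set.Ici 0)) (h1 : Integrable f (gammaMeasure a b))
    (h2 : Integrable f (gammaMeasure (a + 1) b)) :
    ∫ t, f t ∂(gammaMeasure a b) ≤ ∫ t, f t ∂(gammaMeasure (a + 1) b) := by
  have ha1 : 0 < a + 1 := by linarith
  set p := gammaPDFReal a b
  set q := gammaPDFReal (a + 1) b
  have hc : ∀ {a' : ℝ}, 0 < a' → Integrable (gammaPDFReal a' b) ∧
      ∫ t, gammaPDFReal a' b t = 1 := fun {a'} ha' => by
    have := isProbabilityMeasure_gammaMeasure ha' hb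
    constructor
    · simpa using (integrable_gammaMeasure_iff ha' hb (f := fun _ => 1)).1 (integrable_const 1)
    · simpa using (integral_gammaMeasure ha' hb (fun _ => 1)).symm
  rw [integrable_gammaMeasure_iff ha hb] at h1
  rw [integrable_gammaMeasure_iff ha1 hb] at h2
  rw [integral_gammaMeasure ha hb, integral_gammaMeasure ha1 hb]
  -- The density ratio `q / p = b t / a` is increasing and crosses `1` at `a / b`, so `q - p` and `f
  -- - f (a / b)` have the same sign. Since `q - p` has integral zero, integrating gives the claim.
  have hpt : ∀ t, f (a / b) * (q t - p t) ≤ q t * f t - p t * f t := fun t => by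
    rcases lt_or_ge t 0 with ht | ht
    · have hp : p t = 0 := if_neg (not_le.2 ht)
      have hq : q t = 0 := if_neg (not_le.2 ht)
      simp [hp, hq]
    · have hq : q t = p t * (b * t / a) := gammaPDFReal_add_one ha hb
      have hp : 0 ≤ p t := gammaPDFReal_nonneg ha hb t
      have h0 : (0 : ℝ) ≤ a / b := by positivity
      rw [hq]
      have key : 0 ≤ (f t - f (a / b)) * (b * t / a - 1) := by
        rcases le_total t (a / b) with h | h
        · refine mul_nonneg_of_nonpos_of_nonpos (sub_nonpos.2 (hf ht h0 h)) (sub_nonpos.2 ?_)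
          rw [div_le_one ha]; rw [le_div_iff₀ hb] at h; linarith
        · refine mul_nonneg (sub_nonneg.2 (hf h0 ht h)) (sub_nonneg.2 ?_)
          rw [one_le_div ha]; rw [div_le_iff₀ hb] at h; linarith
      nlinarith [mul_nonneg hp key]
  have := integral_mono (((hc ha1).1.sub (hc ha).1).const_mul (f (a / b))) (h2.sub h1) hpt
  have e1 : ∫ t, f (a / b) * (q t - p t) = 0 := by
    rw [integral_const_mul, integral_sub (hc ha1).1 (hc ha).1, (hc ha1).2, (hc ha).2]; simp
  have e2 := integral_sub h2 h1
  simp only [Pi.sub_apply] at this e2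
  linarith

end Gamma

/-! ### Monotonicity of rewards and of the maximal net reward rate. -/

section Rewards

variable {m S : ℕ}

theorem waitLaw_of_le {c s : ℕ} (μ : ℝ) (h : c ≤ s) :
    waitLaw c μ s = ProbabilityTheory.gammaMeasure ((s - c + 1 : ℕ) : ℝ) ((c : ℝ) * μ) :=
  if_neg (not_lt.2 h)

theorem AdmissionQueue.expectedReward_of_lt_servers (Q : AdmissionQueue m S) (i : Fin m) {s : ℕ}
    (hs : s < Q.servers) : Q.expectedReward i s = Q.reward i := by
  simp [AdmissionQueue.expectedReward, waitLaw, hs, Q.cost_zero]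

/-- The wait is zero while a server is free, then Erlang with a shape growing by one per state. At
the transition only nonnegativity of the cost on `[0, ∞)` matters. -/
theorem AdmissionQueue.expectedReward_succ_le (Q : AdmissionQueue m S) (i : Fin m) {s : ℕ}
    (hs : s + 1 < S) : Q.expectedReward i (s + 1) ≤ Q.expectedReward i s := by
  have hcm : 0 < (Q.servers : ℝ) * Q.mu := mul_pos (Nat.cast_pos.2 Q.servers_pos) Q.mu_pos
  by_cases h1 : s + 1 < Q.servers
  · rw [Q.expectedReward_of_lt_servers i h1, Q.expectedReward_of_lt_servers i (by omega)]
  by_cases h2 : s < Q.servers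
  · rw [Q.expectedReward_of_lt_servers i h2, AdmissionQueue.expectedReward, sub_le_self_iff,
      waitLaw, if_neg h1, integral_gammaMeasure (by positivity) hcm]
    refine integral_nonneg fun t => ?_
    rcases lt_or_ge t 0 with ht | ht
    · simp [ProbabilityTheory.gammaPDFReal, not_le.2 ht]
    · refine mul_nonneg (ProbabilityTheory.gammaPDFReal_nonneg (by positivity) hcm t) ?_
      rw [← Q.cost_zero i]
      exact Q.cost_mono i Set.self_mem_Ici ht ht
  · have i1 := Q.cost_integrable i s (by omega)
    have i2 := Q.cost_integrable i (s + 1) hs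
    have e : ((s + 1 - Q.servers + 1 : ℕ) : ℝ) = ((s - Q.servers + 1 : ℕ) : ℝ) + 1 := by
      rw [← Nat.cast_add_one]; congr 1; omega
    unfold AdmissionQueue.expectedReward
    rw [waitLaw_of_le _ (not_lt.1 h2)] at i1 ⊢
    rw [waitLaw_of_le _ (not_lt.1 h1), e] at i2 ⊢
    exact sub_le_sub_left
      (integral_gammaMeasure_le_add_one (by positivity) hcm (Q.cost_mono i) i1 i2) _

/-- If all upper sums of `d` with respect to the priority `r` are nonnegative, then so is the sum
of `d` with nonnegative weights that increase with the priority. -/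
theorem sum_mul_nonneg_of_upper_sums {ι : Type*} [Fintype ι] (r d : ι → ℝ)
    (hd : ∀ i, 0 ≤ ∑ j with r i ≤ r j, d j) (w : ι → ℝ) (hw : ∀ i, 0 ≤ w i)
    (hmono : ∀ i j, r i ≤ r j → w i ≤ w j) : 0 ≤ ∑ j, w j * d j := by
  classical
  -- Abel summation: the support of `w` is an upper set for `r`. Subtracting the weight of its
  -- lowest-priority element `i` on that set splits off a multiple of an upper sum and leaves
  -- monotone weights with smaller support.
  induction hn : (Finset.univ.filter fun j => 0 < w j).card using Nat.strong_induction_on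
    generalizing w with
  | _ n ih =>
    set T := Finset.univ.filter fun j => 0 < w j with hT
    rcases T.eq_empty_or_nonempty with he | hne
    · refine (Finset.sum_eq_zero fun j _ => ?_).ge
      have : j ∉ T := by simp [he]
      have : w j = 0 := le_antisymm (by simpa [hT] using this) (hw j)
      simp [this]
    · obtain ⟨i, hiT, hi⟩ := T.exists_min_image r hne
      have hTi : ∀ j, j ∈ T ↔ r i ≤ r j := fun j =>
        ⟨hi j, fun h => by
          have h0 : 0 < w i := by simpa [hT] using hiT
          simpa [hT] using h0.trans_le (hmono i j h)⟩
      have hTf : (Finset.univ.filter fun j => r i ≤ r j) = T := by ext j; simp [hTi]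
      have hwi : 0 < w i := by simpa [hT] using hiT
      set w' : ι → ℝ := fun j => if j ∈ T then w j - w i else 0 with hw'
      have hwout : ∀ j, j ∉ T → w j = 0 := fun j hj =>
        le_antisymm (by simpa [hT] using hj) (hw j)
      have hsplit : ∑ j, w j * d j = w i * ∑ j ∈ T, d j + ∑ j, w' j * d j := by
        have : ∀ j, w j * d j = (if j ∈ T then w i * d j else 0) + w' j * d j := fun j => by
          by_cases hj : j ∈ T
          · simp only [hw', if_pos hj]; ring
          · simp [hw', hj, hwout j hj]
        simp_rw [this, Finset.sum_add_distrib, Finset.mul_sum]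
        simp
      have hw'0 : ∀ j, 0 ≤ w' j := fun j => by
        simp only [hw']; split_ifs with hj
        · exact sub_nonneg.2 (hmono i j ((hTi j).1 hj))
        · exact le_rfl
      rw [hsplit]
      refine add_nonneg (mul_nonneg hwi.le (hTf ▸ hd i)) (ih _ ?_ w' hw'0 (fun j k hjk => ?_) rfl)
      · rw [← hn]
        refine Finset.card_lt_card (Finset.ssubset_iff_of_subset (fun j hj => ?_) |>.2 ⟨i, hiT, ?_⟩)
        · by_contra hj'
          simp [hw', hj'] at hj
        · simp [hw', hiT]
      · by_cases hj : j ∈ T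
        · have hk : k ∈ T := (hTi k).2 (((hTi j).1 hj).trans hjk)
          simp only [hw', if_pos hj, if_pos hk]
          linarith [hmono j k hjk]
        · simp only [hw', if_neg hj]
          exact hw'0 k

/-- `∑ᵢ λ⁽ⁱ⁾(s) (r⁽ⁱ⁾(s) - y)⁺`: the largest net reward rate in state `s` when admitting a job
costs `y`. -/
noncomputable def netRewardRate (Q : AdmissionQueue m S) (M : ArrivalModel m S)
    (s : Fin (S + 1)) (y : ℝ) : ℝ :=
  ∑ i, M.rate s i * max (Q.expectedReward i s - y) 0

variable {Q : AdmissionQueue m S} {K : ConfidenceSet m} {M : ArrivalModel m S}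

theorem ConfidenceSet.Contains.totalRate_pos (hM : K.Contains M) : 0 < M.totalRate :=
  K.rateMin_pos.trans_le hM.1.2.1

theorem ConfidenceSet.Contains.rate_nonneg (hM : K.Contains M) (s : Fin (S + 1)) (i : Fin m) :
    0 ≤ M.rate s i :=
  mul_nonneg hM.totalRate_pos.le ((hM.2 s).1.1 i)

theorem netRewardRate_antitone (hM : K.Contains M) (s : Fin (S + 1)) :
    Antitone (netRewardRate Q M s) := fun _ _ hxy =>
  Finset.sum_le_sum fun i _ => mul_le_mul_of_nonneg_left
    (max_le_max_right 0 (sub_le_sub_left hxy _)) (hM.rate_nonneg s i)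

theorem netRewardRate_nonneg (hM : K.Contains M) (s : Fin (S + 1)) (y : ℝ) :
    0 ≤ netRewardRate Q M s y :=
  Finset.sum_nonneg fun i _ => mul_nonneg (hM.rate_nonneg s i) (le_max_right _ _)

/-- A class with a positive contribution at `x` contributes strictly less at `y`. -/
theorem netRewardRate_lt (hM : K.Contains M) (s : Fin (S + 1)) {x y : ℝ} (hxy : x < y)
    (hx : 0 < netRewardRate Q M s x) : netRewardRate Q M s y < netRewardRate Q M s x := by
  obtain ⟨i, hi, hpos⟩ := Finset.exists_lt_of_sum_lt
    (s := Finset.univ) (f := fun _ => (0 : ℝ)) (g := fun i => M.rate s i *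
      max (Q.expectedReward i s - x) 0) (by simpa [netRewardRate] using hx)
  refine Finset.sum_lt_sum (fun j _ => mul_le_mul_of_nonneg_left
    (max_le_max_right 0 (sub_le_sub_left hxy.le _)) (hM.rate_nonneg s j)) ⟨i, hi, ?_⟩
  have hr : 0 < M.rate s i := pos_of_mul_pos_left hpos (le_max_right _ _)
  have hm : 0 < max (Q.expectedReward i s - x) 0 := pos_of_mul_pos_right hpos hr.le
  refine mul_lt_mul_of_pos_left (max_lt ?_ hm) hr
  exact (sub_lt_sub_left hxy _).trans_le (le_max_left _ _)

/-- Raise the rewards from state `t` to state `s`, then replace the probabilities: `(r(s) - y)⁺`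
increases with the priority, and those of state `s` have the largest upper sums among all vectors of
the confidence region. -/
theorem netRewardRate_le_of_isOptimistic (hM : K.Contains M) (hopt : K.IsOptimistic Q M)
    {s : ℕ} (hs : s < S) (t : Fin (S + 1))
    (hr : ∀ i, Q.expectedReward i t ≤ Q.expectedReward i s) (y : ℝ) :
    netRewardRate Q M t y ≤ netRewardRate Q M ⟨s, by omega⟩ y := by
  refine (Finset.sum_le_sum fun i _ => mul_le_mul_of_nonneg_left
    (max_le_max_right 0 (sub_le_sub_right (hr i) y)) (hM.rate_nonneg t i)).trans ?_
  have h := sum_mul_nonneg_of_upper_sums (fun i => Q.expectedReward i s)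
    (fun i => M.prob ⟨s, by omega⟩ i - M.prob t i)
    (fun i => by
      rw [Finset.sum_sub_distrib, sub_nonneg]
      exact hopt ⟨s, hs⟩ i _ (hM.2 t))
    (fun i => max (Q.expectedReward i s - y) 0) (fun i => le_max_right _ _)
    (fun i j hij => max_le_max_right 0 (sub_le_sub_right hij y))
  have h2 := mul_nonneg hM.totalRate_pos.le h
  rw [← sub_nonneg, netRewardRate, ← Finset.sum_sub_distrib]
  rw [Finset.mul_sum] at h2
  refine h2.trans_eq (Finset.sum_congr rfl fun i _ => ?_)
  simp only [ArrivalModel.rate]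
  ring

theorem netRewardRate_succ_le (hM : K.Contains M) (hopt : K.IsOptimistic Q M)
    {s : ℕ} (hs : s + 1 < S) (y : ℝ) :
    netRewardRate Q M ⟨s + 1, by omega⟩ y ≤ netRewardRate Q M ⟨s, by omega⟩ y :=
  netRewardRate_le_of_isOptimistic hM hopt (by omega) _
    (fun i => Q.expectedReward_succ_le i hs) y

/-- Both states have the same rewards, so each of the two optimistic vectors is at least as good as
the other. -/
theorem netRewardRate_succ_eq (hM : K.Contains M) (hopt : K.IsOptimistic Q M)
    {s : ℕ} (hs : s + 1 < S) (hc : s + 1 < Q.servers) (y : ℝ) :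
    netRewardRate Q M ⟨s + 1, by omega⟩ y = netRewardRate Q M ⟨s, by omega⟩ y :=
  (netRewardRate_succ_le hM hopt hs y).antisymm
    (netRewardRate_le_of_isOptimistic hM hopt hs ⟨s, by omega⟩ (fun i => by
      rw [Q.expectedReward_of_lt_servers i hc,
        Q.expectedReward_of_lt_servers i (show s < Q.servers by omega)]) y)

theorem netRewardRate_zero_zero (Q : AdmissionQueue m S) (M : ArrivalModel m S) :
    netRewardRate Q M 0 0 = ∑ i, M.rate 0 i * Q.reward i := by
  refine Finset.sum_congr rfl fun i _ => ?_
  simp [Q.expectedReward_of_lt_servers i Q.servers_pos, Q.reward_nonneg i]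

theorem netRewardRate_le_zero (hM : K.Contains M) (hopt : K.IsOptimistic Q M)
    {s : ℕ} (hs : s < S) (y : ℝ) :
    netRewardRate Q M ⟨s, by omega⟩ y ≤ netRewardRate Q M 0 y := by
  induction s with
  | zero => exact le_rfl
  | succ s ih => exact (netRewardRate_succ_le hM hopt hs y).trans (ih (by omega))

theorem rewardRate_sub_le_netRewardRate (hM : K.Contains M) (π : Policy m S) (s : Fin (S + 1))
    (y : ℝ) : rewardRate Q M π s - birthRate M π s * y ≤ netRewardRate Q M s y := by
  rw [rewardRate, birthRate, Finset.sum_mul, ← Finset.sum_sub_distrib]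
  calc _ ≤ ∑ i ∈ accepted π s, M.rate s i * max (Q.expectedReward i s - y) 0 :=
        Finset.sum_le_sum fun i _ => by
          rw [← mul_sub]
          exact mul_le_mul_of_nonneg_left (le_max_left _ _) (hM.rate_nonneg s i)
    _ ≤ _ := Finset.sum_le_sum_of_subset_of_nonneg (Finset.subset_univ _)
        fun i _ _ => mul_nonneg (hM.rate_nonneg s i) (le_max_right _ _)

/-- Admitting exactly the classes whose reward exceeds `y` achieves the largest net reward rate. -/
theorem exists_netRewardRate_eq (Q : AdmissionQueue m S) (M : ArrivalModel m S)
    {s : Fin (S + 1)} (hs : (s : ℕ) < S) (y : ℝ) :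
    ∃ a : Finset (Fin m), ∀ π : Policy m S, π s = a →
      netRewardRate Q M s y = rewardRate Q M π s - birthRate M π s * y := by
  refine ⟨Finset.univ.filter fun i => 0 < Q.expectedReward i s - y, fun π hπ => ?_⟩
  rw [rewardRate, birthRate, accepted, if_pos hs, hπ, Finset.sum_mul, ← Finset.sum_sub_distrib,
    netRewardRate, Finset.sum_filter]
  refine Finset.sum_congr rfl fun i _ => ?_
  split_ifs with h
  · rw [max_eq_left h.le]; ring
  · rw [max_eq_right (not_lt.1 h), mul_zero]

end Rewards

/-! ### Real recursions: optimality equation and policy improvement. -/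

section Sequences

/-- The differences of a solution of the optimality equation of a birth-and-death process with
capacity `N` are positive and largest in the last state. -/
theorem bellman_differences_bounds {N c : ℕ} (hN : 0 < N) (hc : 0 < c) {μ : ℕ → ℝ}
    (hμ0 : μ 0 = 0) (hμpos : ∀ s, 0 < s → 0 < μ s) (hμlt : ∀ s < c, μ s < μ (s + 1))
    (hμc : ∀ s, c ≤ s → μ (s + 1) = μ s) {G : ℕ → ℝ → ℝ} (hGnn : ∀ s < N, ∀ y, 0 ≤ G s y)
    (hanti : ∀ s < N, Antitone (G s))
    (hstrict : ∀ s < N, ∀ y z, y < z → 0 < G s y → G s z < G s y)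
    (hG0 : ∀ s < N, ∀ y, G s y ≤ G 0 y) (hGle : ∀ s, s + 1 < N → ∀ y, G (s + 1) y ≤ G s y)
    (hGeq : ∀ s, s + 1 < N → s + 1 < c → ∀ y, G (s + 1) y = G s y) {x : ℕ → ℝ} {ρ : ℝ}
    (hρ : 0 < ρ) (hB : ∀ s < N, ρ = G s (x s) + μ s * x (s - 1))
    (hBN : ρ = μ N * x (N - 1)) {s : ℕ} (hs : s < N) :
    0 < x s ∧ x s ≤ x (N - 1) := by
  have hμnn : ∀ s, 0 ≤ μ s := fun s => by
    rcases s.eq_zero_or_pos with rfl | h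
    · exact hμ0.ge
    · exact (hμpos s h).le
  -- If `x 0 ≤ 0`, no later `x (s+1)` can be the first positive one: that would give `G (s+1) 0 > G
  -- (s+1) (x (s+1)) ≥ ρ = G 0 (x 0) ≥ G 0 0`. But then `ρ = μ N * x (N-1) ≤ 0`.
  have hx0 : 0 < x 0 := by
    by_contra! h0
    have hall : ∀ s < N, x s ≤ 0 := fun s => by
      induction s with
      | zero => exact fun _ => h0
      | succ s ih =>
        intro hs
        by_contra! hpos
        have e0 := hB 0 hN
        have e1 := hB (s + 1) hs
        rw [hμ0] at e0
        rw [Nat.add_sub_cancel] at e1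
        have h1 := mul_nonpos_of_nonneg_of_nonpos (hμnn (s + 1)) (ih (by omega))
        have h2 := hanti _ hs hpos.le
        have h3 := hstrict _ hs 0 _ hpos (by linarith)
        have h4 := hG0 _ hs 0
        have h5 := hanti 0 hN h0
        linarith
    have := mul_nonpos_of_nonneg_of_nonpos (hμnn N) (hall (N - 1) (by omega))
    linarith
  -- Free servers, upwards: a decrease after `x s` would give `μ (s+1) * x s ≤ μ s * x (s-1) ≤ μ s *
  -- x s`, against `μ s < μ (s+1)`. At `s = 0` the comparison is `x 0 ≤ x 0`.
  have hfwd : ∀ s, s < N → s < c → 0 < x s ∧ x (s - 1) ≤ x s := fun s => by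
    induction s with
    | zero => exact fun _ _ => ⟨hx0, le_rfl⟩
    | succ s ih =>
      intro hs hsc
      obtain ⟨hp, hle⟩ := ih (by omega) (by omega)
      suffices x s ≤ x (s + 1) from ⟨hp.trans_le this, this⟩
      by_contra! hlt
      have e0 := hB s (by omega)
      have e1 := hB (s + 1) hs
      rw [Nat.add_sub_cancel] at e1
      have h1 := hanti _ hs hlt.le
      rw [hGeq s hs hsc (x s)] at h1
      have h2 := mul_le_mul_of_nonneg_left hle (hμnn s)
      have h3 := mul_lt_mul_of_pos_right (hμlt s (by omega)) hp
      linarith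
  -- Busy servers: with a constant service rate and `G` nonincreasing in the state, a decrease
  -- propagates up to `N - 1`, where it contradicts `ρ = μ N * x (N-1)` and `G ≥ 0`.
  have hbwd : ∀ s, s < N → c ≤ s → x (s - 1) ≤ x s := fun s hs hcs => by
    by_contra! hlt
    have hall : ∀ j, s + j < N → x (s + j) < x (s + j - 1) := fun j => by
      induction j with
      | zero => exact fun _ => hlt
      | succ j ih =>
        intro hj
        have hlt' := ih (by omega)
        by_contra! hge
        have e0 := hB (s + j) (by omega)
        have e1 := hB (s + (j + 1)) hj
        rw [← add_assoc, Nat.add_sub_cancel] at hge e1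
        rw [hμc (s + j) (by omega)] at e1
        have h1 := hanti (s + j + 1) hj hge
        have h3 := hGle (s + j) hj (x (s + j))
        have h4 := mul_lt_mul_of_pos_left hlt' (hμpos (s + j) (by omega))
        linarith
    have h := hall (N - 1 - s) (by omega)
    rw [show s + (N - 1 - s) = N - 1 by omega] at h
    have e := hB (N - 1) (by omega)
    have hμN : μ N = μ (N - 1) := by
      conv_lhs => rw [← Nat.sub_add_cancel hN]
      exact hμc _ (by omega)
    rw [hμN] at hBN
    have h1 := mul_lt_mul_of_pos_left h (hμpos (N - 1) (by omega))
    have h2 := hGnn (N - 1) (by omega) (x (N - 1))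
    linarith
  have hstep : ∀ s, s + 1 < N → x s ≤ x (s + 1) := fun s hs => by
    rcases lt_or_ge (s + 1) c with h | h
    · exact (hfwd _ hs h).2
    · exact hbwd _ hs h
  have hmono : ∀ s t, s ≤ t → t < N → x s ≤ x t := fun s t hst => by
    induction t, hst using Nat.le_induction with
    | base => exact fun _ => le_rfl
    | succ t _ ih => exact fun ht => (ih (by omega)).trans (hstep t ht)
  exact ⟨hx0.trans_le (hmono 0 s s.zero_le hs), hmono s _ (by omega) (by omega)⟩

/-- While a server is free it is not optimal to reject every job. -/
theorem false_of_reject_all_of_free_server {k : ℕ} {μ : ℕ → ℝ} (hμ0 : μ 0 = 0)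
    (hμlt : ∀ s ≤ k, μ s < μ (s + 1)) {g : ℝ → ℝ} (hg : Antitone g) (hg0 : ∀ y, 0 ≤ g y)
    {x : ℕ → ℝ} {ρ : ℝ} (hρ : 0 < ρ) (hB : ∀ s ≤ k, ρ = g (x s) + μ s * x (s - 1))
    (hk : ρ = μ k * x (k - 1)) (hxk : ρ = μ (k + 1) * x k) : False := by
  have hμ : ∀ s ≤ k + 1, 0 ≤ μ s := fun s => by
    induction s with
    | zero => exact fun _ => hμ0.ge
    | succ s ih => exact fun hs => (ih (by omega)).trans (hμlt s (by omega)).le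
  -- Downwards from `k`: if `g` vanishes at `x (k-j)`, then `μ (k-j) * x (k-j-1) = ρ = μ (k-j+1) * x
  -- (k-j)`. Rates increase, so `x (k-j-1) ≥ x (k-j)` and `g` vanishes there too; in state `0` this
  -- leaves `ρ = 0`.
  have hall : ∀ j ≤ k, g (x (k - j)) = 0 ∧ ρ = μ (k - j + 1) * x (k - j) := fun j => by
    induction j with
    | zero =>
      intro _
      have := hB k le_rfl
      exact ⟨by simpa using (by linarith : g (x k) = 0), hxk⟩
    | succ j ih =>
      intro hj
      obtain ⟨hz, hx⟩ := ih (by omega)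
      have e := hB (k - j) (by omega)
      have h1 : k - j = k - (j + 1) + 1 := by omega
      rw [hz, zero_add, show k - j - 1 = k - (j + 1) by omega] at e
      refine ⟨?_, h1 ▸ e⟩
      refine le_antisymm ((hg ?_).trans_eq hz) (hg0 _)
      have hp : 0 < μ (k - j) := h1 ▸ (hμ _ (by omega)).trans_lt (hμlt (k - (j + 1)) (by omega))
      have hlt := hμlt (k - j) (by omega)
      have hp' := hp.trans hlt
      have hxpos : 0 < x (k - j) := pos_of_mul_pos_right (hx ▸ hρ) hp'.le
      refine le_of_mul_le_mul_left ?_ hp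
      have := mul_lt_mul_of_pos_right hlt hxpos
      linarith
  have h := (hall k le_rfl).1
  have e := hB 0 k.zero_le
  rw [Nat.sub_self] at h
  rw [h, hμ0] at e
  linarith

/-- Policy improvement: a policy whose action has a nonnegative advantage over `(ρ, x)` in every
state, and a positive one in a state that it reaches from `0`, has a larger average reward. -/
theorem lt_of_policy_improvement {S k : ℕ} (hk : k ≤ S) {μ L R x x' : ℕ → ℝ} {ρ ρ' : ℝ}
    (hμ0 : μ 0 = 0) (hμpos : ∀ s, 0 < s → 0 < μ s) (hL : ∀ s ≤ S, 0 ≤ L s) (hLS : L S = 0)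
    (hLk : ∀ s < k, 0 < L s) (hadv : ∀ s ≤ S, ρ ≤ R s - L s * x s + μ s * x (s - 1))
    (hadvk : ρ < R k - L k * x k + μ k * x (k - 1))
    (hx' : ∀ s ≤ S, ρ' = R s - L s * x' s + μ s * x' (s - 1)) : ρ < ρ' := by
  by_contra! hle
  -- For `D = x' - x`, this reads `μ s * D (s-1) ≤ L s * D s`. Nonnegativity of `D` passes from `0`
  -- up to `k`, becomes strict at `k`, and reaches `S`, where `L S = 0`.
  have hstep : ∀ s ≤ S, μ s * (x' (s - 1) - x (s - 1)) ≤ L s * (x' s - x s) := fun s hs => by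
    have := hadv s hs; have := hx' s hs; linarith
  have hlow : ∀ s ≤ k, 0 ≤ μ s * (x' (s - 1) - x (s - 1)) := fun s => by
    induction s with
    | zero => intro _; rw [hμ0, zero_mul]
    | succ s ih =>
      intro hs
      have h1 := (ih (by omega)).trans (hstep s (by omega))
      exact mul_nonneg (hμpos _ s.succ_pos).le (nonneg_of_mul_nonneg_right h1 (hLk s hs))
  have hhigh : ∀ s, k ≤ s → s ≤ S → 0 < L s * (x' s - x s) := fun s hs => by
    induction s, hs using Nat.le_induction with
    | base =>
      intro _
      have := hlow k le_rfl; have := hx' k hk; linarith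
    | succ s _ ih =>
      intro hs
      have h1 := pos_of_mul_pos_right (ih (by omega)) (hL s (by omega))
      exact (mul_pos (hμpos _ s.succ_pos) h1).trans_le (hstep _ hs)
  simpa [hLS] using hhigh S hk le_rfl

end Sequences

/-! ### Bounds for gain optimal policies and Bellman solutions. -/

section GainOptimal

variable {m S : ℕ} {Q : AdmissionQueue m S} {K : ConfidenceSet m} {M : ArrivalModel m S}

theorem IsBias.averageReward_le (hM : K.Contains M) (hopt : K.IsOptimistic Q M)
    {π : Policy m S} {ρ : ℝ} {h : Fin (S + 1) → ℝ} (hb : IsBias Q M π ρ h) :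
    ρ ≤ ∑ i, M.rate 0 i * Q.reward i := by
  obtain ⟨s, hs⟩ := hb.exists_le_rewardRate hM.rate_nonneg
  refine hs.trans ?_
  rcases lt_or_ge (s : ℕ) S with h1 | h1
  · rw [← netRewardRate_zero_zero]
    have h2 := rewardRate_sub_le_netRewardRate (Q := Q) hM π s 0
    rw [mul_zero, sub_zero] at h2
    exact h2.trans (netRewardRate_le_zero hM hopt h1 0)
  · rw [rewardRate_eq_zero (by omega)]
    exact Finset.sum_nonneg fun i _ => mul_nonneg (hM.rate_nonneg 0 i) (Q.reward_nonneg i)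

theorem sum_rate_mul_reward_le (hM : K.Contains M) {Rmax : ℝ} (hR : ∀ i, Q.reward i ≤ Rmax) :
    ∑ i, M.rate 0 i * Q.reward i ≤ K.rateMax * Rmax := by
  have hsum : ∑ i, M.prob 0 i = 1 := (hM.2 0).1.2
  -- There is at least one class, since the probabilities sum to one.
  have hR0 : 0 ≤ Rmax := by
    obtain ⟨i, _, _⟩ := Finset.exists_ne_zero_of_sum_ne_zero (hsum.trans_ne one_ne_zero)
    exact (Q.reward_nonneg i).trans (hR i)
  calc ∑ i, M.rate 0 i * Q.reward i ≤ ∑ i, M.rate 0 i * Rmax :=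
        Finset.sum_le_sum fun i _ => mul_le_mul_of_nonneg_left (hR i) (hM.rate_nonneg 0 i)
    _ = M.totalRate * Rmax := by
        simp only [ArrivalModel.rate]
        rw [← Finset.sum_mul, ← Finset.mul_sum, hsum, mul_one]
    _ ≤ K.rateMax * Rmax := mul_le_mul_of_nonneg_right hM.1.2.2 hR0

theorem rewardRate_congr {π π' : Policy m S} {s : Fin (S + 1)} (h : π s = π' s) :
    rewardRate Q M π s = rewardRate Q M π' s := by
  simp [rewardRate, accepted, h]

theorem birthRate_congr {π π' : Policy m S} {s : Fin (S + 1)} (h : π s = π' s) :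
    birthRate M π s = birthRate M π' s := by
  simp [birthRate, accepted, h]

theorem rewardRate_of_empty {π : Policy m S} {s : Fin (S + 1)} (h : π s = ∅) :
    rewardRate Q M π s = 0 := by
  simp [rewardRate, accepted, h]

theorem birthRate_of_empty {π : Policy m S} {s : Fin (S + 1)} (h : π s = ∅) :
    birthRate M π s = 0 := by
  simp [birthRate, accepted, h]

theorem rewardRate_eq_zero_of_birthRate (hM : K.Contains M) {π : Policy m S} {s : Fin (S + 1)}
    (h : birthRate M π s = 0) : rewardRate Q M π s = 0 := by
  rw [birthRate, Finset.sum_eq_zero_iff_of_nonneg fun i _ => hM.rate_nonneg s i] at h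
  exact Finset.sum_eq_zero fun i hi => by rw [h i hi, zero_mul]

/-- The pair `(ρ, x)` need not come from a policy. It is applied to `(0, 0)` and to a bias altered
from the first state of zero birth rate on. -/
theorem exists_averageReward_gt_of_advantage (hM : K.Contains M) (π : Policy m S) {x : ℕ → ℝ}
    {ρ : ℝ} (k : Fin (S + 1)) (hreach : ∀ s < k, 0 < birthRate M π s)
    (hadv : ∀ s : Fin (S + 1), ρ ≤ rewardRate Q M π s - birthRate M π s * x s +
      Q.serviceRate s * x ((s : ℕ) - 1))
    (hadvk : ρ < rewardRate Q M π k - birthRate M π k * x k +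
      Q.serviceRate k * x ((k : ℕ) - 1)) :
    ∃ ρ', IsAverageReward Q M π ρ' ∧ ρ < ρ' := by
  obtain ⟨ρ', h, hb⟩ := exists_isBias Q hM.rate_nonneg π
  refine ⟨ρ', hb.isAverageReward hM.rate_nonneg, ?_⟩
  rw [isBias_iff] at hb
  let ext : (Fin (S + 1) → ℝ) → ℕ → ℝ := fun f n => if hn : n < S + 1 then f ⟨n, hn⟩ else 0
  have hext : ∀ f (n : ℕ) (hn : n ≤ S), ext f n = f ⟨n, by omega⟩ := fun f n hn =>
    dif_pos (by omega)
  have hk : (k : ℕ) ≤ S := by omega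
  refine lt_of_policy_improvement hk (μ := Q.serviceRate) (L := ext (birthRate M π))
    (R := ext (rewardRate Q M π)) (x := x) (x' := relativeBiasExt h) Q.serviceRate_zero
    (fun s => Q.serviceRate_pos) ?_ ?_ ?_ ?_ ?_ ?_
  · intro s hs; rw [hext _ _ hs]; exact birthRate_nonneg hM.rate_nonneg _ _
  · rw [hext _ _ le_rfl, birthRate_eq_zero rfl]
  · intro s hs; rw [hext _ _ (by omega)]; exact hreach _ hs
  · intro s hs; rw [hext _ _ hs, hext _ _ hs]; exact hadv ⟨s, by omega⟩
  · rw [hext _ _ hk, hext _ _ hk]; exact hadvk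
  · intro s hs; rw [hext _ _ hs, hext _ _ hs]; exact hb ⟨s, by omega⟩

theorem exists_averageReward_pos (hM : K.Contains M) (hS : 0 < S)
    (hpos : ∃ i, 0 < M.rate 0 i ∧ 0 < Q.reward i) :
    ∃ π ρ, IsAverageReward Q M π ρ ∧ 0 < ρ := by
  obtain ⟨i, hi, hRi⟩ := hpos
  let π : Policy m S := fun s => if s = 0 then {i} else ∅
  have h0 : 0 < rewardRate Q M π 0 := by
    simp [rewardRate, accepted, hS, π, Q.expectedReward_of_lt_servers i Q.servers_pos, hi, hRi]
  -- Comparison with `ρ = 0` and `x = 0`; with the gain in state `0` there is nothing to reach.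
  refine ⟨π, exists_averageReward_gt_of_advantage hM π (x := fun _ => 0) 0
    (fun s hs => absurd hs (Fin.not_lt_zero s)) (fun s => ?_) (by simpa using h0)⟩
  by_cases hs : s = 0
  · subst hs; simpa using h0.le
  · simp [rewardRate_of_empty (Q := Q) (M := M) (show π s = ∅ from if_neg hs)]

theorem IsGainOptimal.le_of_isAverageReward {π π' : Policy m S} {ρ ρ' : ℝ}
    (hπ : IsGainOptimal Q M π) (h : IsAverageReward Q M π ρ) (h' : IsAverageReward Q M π' ρ') :
    ρ' ≤ ρ := by
  obtain ⟨ρ₀, h₀, hmax⟩ := hπ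
  exact (hmax π' ρ' h').trans_eq (h₀.unique h)

/-- Bounds for the solution of the optimality equation of the queue truncated at capacity `N`. -/
theorem truncated_bellman_bounds (hM : K.Contains M) (hopt : K.IsOptimistic Q M) {N : ℕ}
    (hN : 0 < N) (hNS : N ≤ S) {x : ℕ → ℝ} {ρ : ℝ} (hρ : 0 < ρ)
    (hB : ∀ (s : ℕ) (hs : s < N), ρ = netRewardRate Q M ⟨s, by omega⟩ (x s) +
      Q.serviceRate s * x (s - 1))
    (hBN : ρ = Q.serviceRate N * x (N - 1)) {s : ℕ} (hs : s < N) :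
    0 < x s ∧ x s ≤ x (N - 1) := by
  let G : ℕ → ℝ → ℝ := fun n y => if hn : n < S + 1 then netRewardRate Q M ⟨n, hn⟩ y else 0
  have hG : ∀ (n : ℕ) (hn : n < N) y, G n y = netRewardRate Q M ⟨n, by omega⟩ y :=
    fun n hn y => dif_pos (by omega)
  refine bellman_differences_bounds hN Q.servers_pos (μ := Q.serviceRate) Q.serviceRate_zero
    (fun s => Q.serviceRate_pos) (fun s => Q.serviceRate_lt_succ)
    (fun s h => by rw [Q.serviceRate_of_le h, Q.serviceRate_of_le (by omega)])
    (G := G) ?_ ?_ ?_ ?_ ?_ ?_ hρ ?_ hBN hs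
  · intro s hs y; rw [hG _ hs]; exact netRewardRate_nonneg hM _ _
  · intro s hs y z hyz; rw [hG _ hs, hG _ hs]; exact netRewardRate_antitone hM _ hyz
  · intro s hs y z hyz; rw [hG _ hs, hG _ hs]; exact netRewardRate_lt hM _ hyz
  · intro s hs y; rw [hG _ hs, hG _ hN]
    exact netRewardRate_le_zero hM hopt (by omega) y
  · intro s hs y; rw [hG _ hs, hG _ (by omega)]
    exact netRewardRate_succ_le hM hopt (by omega) y
  · intro s hs hc y; rw [hG _ hs, hG _ (by omega)]
    exact netRewardRate_succ_eq hM hopt (by omega) hc y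
  · intro s hs; rw [hG _ hs]; exact hB s hs

theorem netRewardRate_eq_zero_of_lt_servers (hM : K.Contains M) (hopt : K.IsOptimistic Q M)
    {s : ℕ} (hs : s < S) (hc : s < Q.servers) (y : ℝ) :
    netRewardRate Q M ⟨s, by omega⟩ y = netRewardRate Q M 0 y := by
  induction s with
  | zero => rfl
  | succ s ih =>
    exact (netRewardRate_succ_eq hM hopt hs hc y).trans (ih (by omega) (by omega))

theorem SatisfiesBellman.eq_netRewardRate (hM : K.Contains M) {ρ : ℝ} {h : Fin (S + 1) → ℝ}
    (hB : SatisfiesBellman Q M ρ h) {s : ℕ} (hs : s < S) :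
    ρ = netRewardRate Q M ⟨s, by omega⟩ (relativeBiasExt h s) +
      Q.serviceRate s * relativeBiasExt h (s - 1) := by
  obtain ⟨⟨a, ha⟩, hmax⟩ := hB ⟨s, by omega⟩
  simp only [generator_mulVec] at ha
  have h1 := rewardRate_sub_le_netRewardRate (Q := Q) hM (fun _ => a) ⟨s, by omega⟩
    (relativeBiasExt h s)
  obtain ⟨b, hb⟩ := exists_netRewardRate_eq Q M (s := ⟨s, by omega⟩) hs (relativeBiasExt h s)
  have h2 := hb (fun _ => b) rfl
  have h3 := hmax ⟨b, rfl⟩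
  simp only [generator_mulVec] at h3
  linarith

theorem IsBias.eq_serviceRateMax_mul {π : Policy m S} {ρ : ℝ} {h : Fin (S + 1) → ℝ}
    (hb : IsBias Q M π ρ h) : ρ = Q.serviceRateMax * relativeBiasExt h (S - 1) := by
  have := (isBias_iff ..).1 hb (Fin.last S)
  rw [rewardRate_eq_zero rfl, birthRate_eq_zero rfl] at this
  simpa [AdmissionQueue.serviceRateMax] using this

theorem reflTransGen_generator_zero (π : Policy m S) (s : Fin (S + 1)) :
    Relation.ReflTransGen (fun x y => 0 < generator Q M π x y) s 0 := by
  induction s using Fin.induction with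
  | zero => exact .refl
  | succ s ih =>
    refine .head ?_ ih
    have h1 : ¬ (s.castSucc : ℕ) = (s.succ : ℕ) + 1 := by simp; omega
    rw [generator, if_neg h1, if_pos (by simp)]
    exact Q.serviceRate_pos s.1.succ_pos

theorem le_of_reflTransGen_generator {π : Policy m S} {j : Fin (S + 1)}
    (hj : birthRate M π j = 0) {s t : Fin (S + 1)} (hs : s ≤ j)
    (h : Relation.ReflTransGen (fun x y => 0 < generator Q M π x y) s t) : t ≤ j := by
  induction h with
  | refl => exact hs
  | @tail b c _ hbc ih =>
    by_contra! hlt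
    have h1 : (b : ℕ) ≤ j := ih
    have h2 : (j : ℕ) < c := hlt
    simp only [generator] at hbc
    split_ifs at hbc with h3 h4 h5
    · have : b = j := Fin.ext (by omega)
      rw [this, hj] at hbc
      exact lt_irrefl _ hbc
    · omega
    · rw [h5] at h1; omega
    · exact lt_irrefl _ hbc

/-- Services lead from every state to `0`, so a recurrent state is reachable from `0`, and no upward
path crosses a state of zero birth rate. -/
theorem IsRecurrentState.birthRate_pos (hM : K.Contains M) {π : Policy m S} {s : Fin S}
    (hs : IsRecurrentState Q M π s.succ) (j : Fin (S + 1)) (hj : (j : ℕ) ≤ s) :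
    0 < birthRate M π j := by
  refine (birthRate_nonneg hM.rate_nonneg π j).lt_of_ne' fun h0 => ?_
  have h1 := le_of_reflTransGen_generator h0 (Fin.zero_le j)
    (hs 0 (reflTransGen_generator_zero π _))
  have h2 : (s : ℕ) + 1 ≤ j := by simpa using Fin.le_def.1 h1
  omega

/-- Let `k` be the last state that a gain optimal policy reaches from `0`. Then the optimality
equation holds up to state `k` when every job is rejected above `k`. -/
theorem IsGainOptimal.netRewardRate_add_le (hM : K.Contains M) {π : Policy m S} {ρ : ℝ}
    {h : Fin (S + 1) → ℝ} (hπ : IsGainOptimal Q M π) (hρ : IsAverageReward Q M π ρ)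
    (hb : IsBias Q M π ρ h) {k : ℕ} (hk : 0 < k)
    (hpos : ∀ j : Fin (S + 1), (j : ℕ) < k → 0 < birthRate M π j)
    {x : ℕ → ℝ} (hx : ∀ n < k, x n = relativeBiasExt h n)
    (hxk : ∀ n, k ≤ n + 1 → ρ = Q.serviceRate (n + 1) * x n) {s : ℕ} (hsk : s ≤ k) (hs : s < S) :
    netRewardRate Q M ⟨s, by omega⟩ (x s) + Q.serviceRate s * x (s - 1) ≤ ρ := by
  by_contra! hlt
  obtain ⟨a, ha⟩ := exists_netRewardRate_eq Q M (s := ⟨s, by omega⟩) hs (x s)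
  -- Deviation to a maximizing action in `s`, with `π` kept elsewhere below `k` and rejection
  -- elsewhere from `k` on. By the bias equation and `hxk`, the advantage is zero outside `s`; it is
  -- positive in `s`, which is still reached from `0`.
  let π' : Policy m S := fun t => if (t : ℕ) = s then a else if (t : ℕ) < k then π t else ∅
  rw [ha π' (if_pos rfl)] at hlt
  have hsame : ∀ t : Fin (S + 1), (t : ℕ) ≠ s → (t : ℕ) < k → π' t = π t := fun t h1 h2 => by
    simp only [π', if_neg h1, if_pos h2]
  have hreach : ∀ t : Fin (S + 1), t < ⟨s, by omega⟩ → 0 < birthRate M π' t := fun t ht => by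
    have ht' : (t : ℕ) < s := ht
    rw [birthRate_congr (hsame t ht'.ne (by omega))]
    exact hpos t (by omega)
  have hadv : ∀ t : Fin (S + 1), ρ ≤ rewardRate Q M π' t - birthRate M π' t * x t +
      Q.serviceRate t * x ((t : ℕ) - 1) := fun t => by
    by_cases h1 : (t : ℕ) = s
    · have : t = ⟨s, by omega⟩ := Fin.ext h1
      rw [this]
      exact hlt.le
    by_cases h2 : (t : ℕ) < k
    · rw [birthRate_congr (hsame t h1 h2), rewardRate_congr (hsame t h1 h2), hx _ h2,
        hx _ (by omega)]
      exact ((isBias_iff ..).1 hb t).le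
    · have he : π' t = ∅ := by simp only [π', if_neg h1, if_neg h2]
      rw [birthRate_of_empty he, rewardRate_of_empty he]
      have := hxk (t - 1) (by omega)
      rw [Nat.sub_add_cancel (by omega)] at this
      linarith
  obtain ⟨ρ', hρ', hgt⟩ := exists_averageReward_gt_of_advantage hM π' ⟨s, _⟩ hreach hadv hlt
  exact hgt.not_ge (hπ.le_of_isAverageReward hρ hρ')

theorem IsGainOptimal.relativeBias_bounds_of_isRecurrentState (hM : K.Contains M)
    (hopt : K.IsOptimistic Q M) {π : Policy m S} {ρ : ℝ} {h : Fin (S + 1) → ℝ}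
    (hπ : IsGainOptimal Q M π) (hρ : IsAverageReward Q M π ρ) (hb : IsBias Q M π ρ h)
    (hρ0 : 0 < ρ) {s : Fin S} (hs : IsRecurrentState Q M π s.succ) :
    0 < relativeBias h s ∧ relativeBias h s ≤ ρ / Q.serviceRateMax := by
  classical
  have hex : ∃ n, ∃ hn : n < S + 1, birthRate M π ⟨n, hn⟩ = 0 :=
    ⟨S, S.lt_succ_self, birthRate_eq_zero rfl⟩
  obtain ⟨k, ⟨hkS, hk0⟩, hkmin⟩ : ∃ k, (∃ hn : k < S + 1, birthRate M π ⟨k, hn⟩ = 0) ∧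
      ∀ n < k, ¬ ∃ hn : n < S + 1, birthRate M π ⟨n, hn⟩ = 0 :=
    ⟨Nat.find hex, Nat.find_spec hex, fun n => Nat.find_min hex⟩
  have hpos : ∀ j : Fin (S + 1), (j : ℕ) < k → 0 < birthRate M π j := fun j hj =>
    (birthRate_nonneg hM.rate_nonneg π j).lt_of_ne' fun h0 => hkmin j hj ⟨j.2, h0⟩
  have hsk : (s : ℕ) < k := by
    by_contra! hle
    exact (hs.birthRate_pos hM ⟨k, hkS⟩ hle).ne' hk0
  have hbk := (isBias_iff ..).1 hb ⟨k, hkS⟩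
  rw [hk0, rewardRate_eq_zero_of_birthRate hM hk0, zero_mul, sub_zero, zero_add] at hbk
  simp only at hbk
  -- From `k` on, the bias of `π` is replaced by the values for which rejecting every job satisfies
  -- the equation.
  set x : ℕ → ℝ := fun n => if n < k then relativeBiasExt h n else ρ / Q.serviceRate (n + 1)
    with hxdef
  have hx : ∀ n < k, x n = relativeBiasExt h n := fun n hn => if_pos hn
  have hxk : ∀ n, k ≤ n + 1 → ρ = Q.serviceRate (n + 1) * x n := fun n hn => by
    by_cases h1 : n < k
    · obtain rfl : k = n + 1 := by omega
      rw [hx _ h1]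
      simpa using hbk
    · simp only [hxdef, if_neg h1]
      have := (Q.serviceRate_pos n.succ_pos).ne'
      field_simp
  have hBk : ρ = Q.serviceRate k * x (k - 1) := by rw [hx _ (by omega)]; exact hbk
  have hle := fun t => hπ.netRewardRate_add_le hM hρ hb (by omega) hpos hx hxk (s := t)
  have hB : ∀ (t : ℕ) (ht : t ≤ k) (htS : t < S), ρ = netRewardRate Q M ⟨t, by omega⟩ (x t) +
      Q.serviceRate t * x (t - 1) := fun t ht htS => by
    refine le_antisymm ?_ (hle t ht htS)
    rcases ht.lt_or_eq with ht | rfl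
    · have h1 := (isBias_iff ..).1 hb ⟨t, by omega⟩
      have h2 := rewardRate_sub_le_netRewardRate (Q := Q) hM π ⟨t, by omega⟩ (x t)
      rw [hx t ht] at h2 ⊢
      rw [hx (t - 1) (by omega)]
      simp only at h1
      linarith
    · have := netRewardRate_nonneg (Q := Q) hM ⟨t, hkS⟩ (x t)
      linarith
  -- Either `k = S`, or all servers are busy in state `k`; otherwise rejecting every job in `k`
  -- would be optimal with a server free.
  have hμk : Q.serviceRate k = Q.serviceRateMax := by
    rcases (Nat.le_of_lt_succ hkS).eq_or_lt with rfl | hkS'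
    · rfl
    rcases le_or_gt Q.servers k with hc | hc
    · rw [AdmissionQueue.serviceRateMax, Q.serviceRate_of_le hc,
        Q.serviceRate_of_le (hc.trans hkS'.le)]
    · refine (false_of_reject_all_of_free_server (k := k) Q.serviceRate_zero
        (fun t ht => Q.serviceRate_lt_succ (by omega)) (netRewardRate_antitone (Q := Q) hM 0)
        (netRewardRate_nonneg hM 0) hρ0 (fun t ht => ?_) hBk (hxk k (by omega))).elim
      rw [← netRewardRate_eq_zero_of_lt_servers hM hopt (by omega : t < S) (by omega)]
      exact hB t ht (by omega)
  have hbd := truncated_bellman_bounds hM hopt (by omega) (by omega : k ≤ S) hρ0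
    (fun t ht => hB t ht.le (by omega)) hBk hsk
  have hμpos : 0 < Q.serviceRate k := Q.serviceRate_pos (by omega)
  rw [← hμk, le_div_iff₀' hμpos, ← relativeBiasExt_val, ← hx _ hsk]
  exact ⟨hbd.1, (mul_le_mul_of_nonneg_left hbd.2 hμpos.le).trans_eq hBk.symm⟩

theorem SatisfiesBellman.relativeBias_bounds (hM : K.Contains M)
    (hopt : K.IsOptimistic Q M) {π : Policy m S} {ρ : ℝ} {h : Fin (S + 1) → ℝ}
    (hB : SatisfiesBellman Q M ρ h) (hb : IsBias Q M π ρ h) (hρ0 : 0 < ρ) (s : Fin S) :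
    0 < relativeBias h s ∧ relativeBias h s ≤ ρ / Q.serviceRateMax := by
  have hS : 0 < S := s.pos
  have hbd := truncated_bellman_bounds hM hopt hS le_rfl hρ0
    (fun t ht => hB.eq_netRewardRate hM ht) hb.eq_serviceRateMax_mul s.2
  have hμpos : 0 < Q.serviceRateMax := Q.serviceRate_pos hS
  rw [le_div_iff₀' hμpos, ← relativeBiasExt_val]
  exact ⟨hbd.1, (mul_le_mul_of_nonneg_left hbd.2 hμpos.le).trans_eq
    hb.eq_serviceRateMax_mul.symm⟩

end GainOptimal

/-! ### The main theorem. -/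

theorem mainTheorem2 {m S : ℕ} (Q : AdmissionQueue m S) (K : ConfidenceSet m)
    (M : ArrivalModel m S) (hM : K.Contains M) (hopt : K.IsOptimistic Q M)
    (Rmax : ℝ) (hRmax : ∀ i, Q.reward i ≤ Rmax) :
    (∀ π : Policy m S, ∃ ρ h, IsAverageReward Q M π ρ ∧ IsBias Q M π ρ h) ∧
    (∀ (π : Policy m S) (ρ : ℝ), IsAverageReward Q M π ρ →
      ρ ≤ ∑ i, M.rate 0 i * Q.reward i ∧
      ∑ i, M.rate 0 i * Q.reward i ≤ K.rateMax * Rmax) ∧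
    ((∃ i, 0 < M.rate 0 i ∧ 0 < Q.reward i) →
      ∀ (π : Policy m S) (ρ : ℝ) (h : Fin (S + 1) → ℝ),
        IsAverageReward Q M π ρ → IsBias Q M π ρ h → IsGainOptimal Q M π →
        ∀ s : Fin S, (IsRecurrentState Q M π s.succ ∨ SatisfiesBellman Q M ρ h) →
          0 < relativeBias h s ∧
          relativeBias h s ≤ ρ / Q.serviceRateMax ∧
          ρ / Q.serviceRateMax ≤ K.rateMax * Rmax / Q.serviceRateMax) := by
  refine ⟨fun π => ?_, fun π ρ hρ => ?_, fun hpos π ρ h hρ hb hπ s hs => ?_⟩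
  · obtain ⟨ρ, h, hb⟩ := exists_isBias Q hM.rate_nonneg π
    exact ⟨ρ, h, hb.isAverageReward hM.rate_nonneg, hb⟩
  · obtain ⟨ρ', h, hb⟩ := exists_isBias Q hM.rate_nonneg π
    rw [hρ.unique (hb.isAverageReward hM.rate_nonneg)]
    exact ⟨hb.averageReward_le hM hopt, sum_rate_mul_reward_le hM hRmax⟩
  · have hS : 0 < S := s.pos
    obtain ⟨π₁, ρ₁, h₁, hρ₁⟩ := exists_averageReward_pos hM hS hpos
    -- Gain optimality over the policy that admits one profitable class in state `0` makes `ρ`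
    -- positive, as both bounds require.
    have hρ0 : 0 < ρ := hρ₁.trans_le (hπ.le_of_isAverageReward hρ h₁)
    have hbd : 0 < relativeBias h s ∧ relativeBias h s ≤ ρ / Q.serviceRateMax :=
      hs.elim (hπ.relativeBias_bounds_of_isRecurrentState hM hopt hρ hb hρ0)
        fun hB => hB.relativeBias_bounds hM hopt hb hρ0 s
    exact ⟨hbd.1, hbd.2, div_le_div_of_nonneg_right
      ((hb.averageReward_le hM hopt).trans (sum_rate_mul_reward_le hM hRmax))
      (Q.serviceRate_nonneg S)⟩
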